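/- Let $n\ge 1$, let $0<\lambda_1<\cdots<\lambda_n$ and $0<\mu_1<\cdots<\mu_n$ be real numbers, and suppose that $\mu_{i+1}-\mu_i$ is a positive integer for every $1\le i\le n-1$. Then for every integer $m\ge 1$ the $n\times n$ matrices $$\left[\Gamma(\lambda_i+\mu_j)^m\right]_{i,j=1}^n \qquad\text{and}\qquad \left[\frac{1}{\beta(\lambda_i,\mu_j)^m}\right]_{i,j=1}^n$$ are totally positive, that is, all their minors (determinants of square submatrices of every size $1\le k\le n$) are positive. Here $\Gamma$ is the gamma function and $\beta(x,y)=\frac{\Gamma(x)\Gamma(y)}{\Gamma(x+y)}$ for $x,y>0$ is the beta function. -/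

import Mathlib

/-- A real matrix is totally positive if all its minors are positive: for every choice of `k` rows
and `k` columns, listed in increasing order, the determinant of the `k × k` submatrix is positive
(for `k = 0` this is the trivial `0 < 1`). -/
def IsTotallyPositive {p q : ℕ} (A : Matrix (Fin p) (Fin q) ℝ) : Prop :=
  ∀ (k : ℕ) (r : Fin k → Fin p) (c : Fin k → Fin q), StrictMono r → StrictMono c →
    0 < (A.submatrix r c).det

/-!
Since the `μ_j` differ by integers, the functional equation gives
`Γ(λ_i + μ_j) = Γ(λ_i + μ_0) * ∏_{a < e_j} (λ_i + μ_0 + a)` with natural numbers `e_0 < e_1 < ⋯`.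
Row and column scalings by positive numbers do not change the signs of minors, and `1 / β` differs
from `Γ(λ_i + μ_j)` by such scalings, so both claims reduce to `0 < det [f_j(x_i)]` for
`0 < x_0 < x_1 < ⋯` and the polynomials `f_j = ∏_{a < e_j} (X + a) ^ m`
(`det_risingProd_pos`).

This positivity is a Descartes-type argument. Multiplication by `X + a` with `a ≥ 0` does not
increase the number of sign changes of the coefficients (`SignChangesLE.X_add_C_mul`), and adding a
constant increases it by at most one (`SignChangesLE.C_add`). As
`∑ c_j f_j = f_0 * (c_0 + (f_1 / f_0) * (c_1 + (f_2 / f_1) * (⋯)))`, a combination of `k + 1` of the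
`f_j` has at most `k` sign changes (`signChangesLE_sum_risingProd`), hence, unless it vanishes, at
most `k` positive zeros (`SignChangesLE.card_le`). As a function `D` of its last node, the
determinant is such a combination; its leading coefficient is positive by induction on the size, and
the earlier nodes are already `k` zeros. So `D` has no zero beyond the earlier nodes, and it is
positive there because it is positive near infinity.
-/

open Polynomial

/-! ### Sign changes of the coefficients of a polynomial -/

/-- The coefficients of `P` change sign at most `d` times: there are signs `(-1) ^ t n`, with `t`
monotone and rising by at most `d` in total, such that the `n`-th coefficient weakly has the
sign `(-1) ^ t n`. Only the parity of `t 0` matters; it encodes the sign of the lowest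
coefficients. -/
def SignChangesLE (P : ℝ[X]) (d : ℕ) : Prop :=
  ∃ t : ℕ → ℕ, Monotone t ∧ (∀ n, t n ≤ t 0 + d) ∧ ∀ n, 0 ≤ (-1 : ℝ) ^ t n * P.coeff n

lemma signChangesLE_C (c : ℝ) : SignChangesLE (C c) 0 := by
  rcases le_total 0 c with h | h
  · refine ⟨fun _ => 0, monotone_const, fun _ => le_rfl, fun n => ?_⟩
    rw [coeff_C]; split_ifs <;> simp [h]
  · refine ⟨fun _ => 1, monotone_const, fun _ => le_rfl, fun n => ?_⟩
    rw [coeff_C]; split_ifs <;> simp [h]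

/-- Each coefficient of `(X + a) * P` is a nonnegative combination of two neighbouring coefficients
of `P`, so it weakly has the sign of one of them. -/
lemma SignChangesLE.X_add_C_mul {P : ℝ[X]} {d : ℕ} (h : SignChangesLE P d) {a : ℝ} (ha : 0 ≤ a) :
    SignChangesLE ((X + C a) * P) d := by
  obtain ⟨t, ht, hd, hs⟩ := h
  have key : ∀ n, ∃ s, t n ≤ s ∧ s ≤ t (n + 1) ∧
      0 ≤ (-1 : ℝ) ^ s * (P.coeff n + a * P.coeff (n + 1)) := by
    intro n
    have h1 := hs n
    have h2 := mul_nonneg ha (hs (n + 1))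
    rcases neg_one_pow_eq_or ℝ (t n) with e1 | e1 <;>
    rcases neg_one_pow_eq_or ℝ (t (n + 1)) with e2 | e2
    · exact ⟨t n, le_rfl, ht n.le_succ, by rw [e1] at h1 ⊢; rw [e2] at h2; linarith⟩
    · rcases le_total 0 (P.coeff n + a * P.coeff (n + 1)) with h3 | h3
      · exact ⟨t n, le_rfl, ht n.le_succ, by rw [e1]; linarith⟩
      · exact ⟨t (n + 1), ht n.le_succ, le_rfl, by rw [e2]; linarith⟩
    · rcases le_total 0 (P.coeff n + a * P.coeff (n + 1)) with h3 | h3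
      · exact ⟨t (n + 1), ht n.le_succ, le_rfl, by rw [e2]; linarith⟩
      · exact ⟨t n, le_rfl, ht n.le_succ, by rw [e1]; linarith⟩
    · exact ⟨t n, le_rfl, ht n.le_succ, by rw [e1] at h1 ⊢; rw [e2] at h2; linarith⟩
  choose s hs1 hs2 hs3 using key
  refine ⟨fun | 0 => t 0 | n + 1 => s n, monotone_nat_of_le_succ fun n => ?_, fun n => ?_,
    fun n => ?_⟩
  · cases n with
    | zero => exact hs1 0
    | succ n => exact (hs2 n).trans (hs1 (n + 1))
  · cases n with
    | zero => exact Nat.le_add_right _ _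
    | succ n => exact (hs2 n).trans (hd _)
  · cases n with
    | zero =>
      have h0 := mul_nonneg ha (hs 0)
      simp only [add_mul, coeff_add, coeff_C_mul, coeff_X_mul_zero, zero_add]
      linarith
    | succ n =>
      simpa only [add_mul, coeff_add, coeff_C_mul, coeff_X_mul] using hs3 n

lemma SignChangesLE.C_add {P : ℝ[X]} {d : ℕ} (h : SignChangesLE P d) (c : ℝ) :
    SignChangesLE (C c + P) (d + 1) := by
  obtain ⟨t, ht, hd, hs⟩ := h
  have h0 : ∀ n, t 0 ≤ t n := fun n => ht n.zero_le
  rcases le_total 0 ((-1 : ℝ) ^ t 0 * (c + P.coeff 0)) with hc | hc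
  · refine ⟨t, ht, fun n => (hd n).trans (by omega), fun n => ?_⟩
    cases n with
    | zero => simpa using hc
    | succ n => simpa [coeff_C] using hs (n + 1)
  · -- The constant coefficient takes the opposite sign; raising `t` by two elsewhere keeps
    -- the other signs.
    refine ⟨fun | 0 => t 0 + 1 | n + 1 => t (n + 1) + 2,
      monotone_nat_of_le_succ fun n => ?_, fun n => ?_, fun n => ?_⟩
    · cases n with
      | zero => have := h0 (0 + 1); simp only; omega
      | succ n => exact Nat.add_le_add_right (ht (Nat.le_succ _)) 2
    · cases n with
      | zero => exact Nat.le_add_right _ _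
      | succ n => have := hd (n + 1); simp only; omega
    · cases n with
      | zero =>
        simp only [coeff_add, coeff_C_zero, pow_succ]
        linarith
      | succ n => simpa [coeff_C, pow_succ] using hs (n + 1)

/-! ### Positive zeros -/

lemma coeff_X_mul_derivative_sub (P : ℝ[X]) (N n : ℕ) :
    (X * derivative P - C (N : ℝ) * P).coeff n = ((n : ℝ) - N) * P.coeff n := by
  cases n with
  | zero => simp
  | succ n => rw [coeff_sub, coeff_X_mul, coeff_derivative, coeff_C_mul]; push_cast; ring

/-- Either the signs of the coefficients of `P` never change, or they first change at some index `N`;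
then `X P' - N P`, whose coefficients are `n - N` times those of `P`, has one sign change less. -/
lemma exists_signChangesLE_X_mul_derivative_sub {P : ℝ[X]} {d : ℕ} (h : SignChangesLE P (d + 1)) :
    SignChangesLE P 0 ∨ ∃ N : ℕ, SignChangesLE (X * derivative P - C (N : ℝ) * P) d := by
  classical
  obtain ⟨t, ht, hd, hs⟩ := h
  by_cases hN : ∃ n, t 0 < t n
  · right
    set N := Nat.find hN with hNdef
    have hlt : ∀ n, n < N → t n = t 0 := fun n hn =>
      le_antisymm (not_lt.mp (Nat.find_min hN hn)) (ht n.zero_le)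
    have hge : ∀ n, N ≤ n → t 0 < t n := fun n hn => (Nat.find_spec hN).trans_le (ht hn)
    have hNpos : 0 < N := Nat.pos_of_ne_zero fun h0 => by
      have := hge 0 h0.le; omega
    -- The sign of `n - N` flips the first block, which merges it with the second one.
    refine ⟨N, fun n => if n < N then t 0 + 1 else t n, fun a b hab => ?_, fun n => ?_,
      fun n => ?_⟩
    · have := ht hab
      have := hge b
      simp only
      split_ifs <;> omega
    · have := hd n
      simp only [hNpos, if_true]
      split_ifs <;> omega
    · rw [coeff_X_mul_derivative_sub]
      have h1 := hs n
      by_cases hn : n < N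
      · simp only [hn, if_true, pow_succ]
        rw [hlt n hn] at h1
        have h2 : (0 : ℝ) ≤ N - n := sub_nonneg.mpr (by exact_mod_cast hn.le)
        have := mul_nonneg h2 h1
        linarith
      · simp only [hn, if_false]
        have h2 : (0 : ℝ) ≤ n - N := sub_nonneg.mpr (by exact_mod_cast not_lt.mp hn)
        have := mul_nonneg h2 h1
        linarith
  · left
    push Not at hN
    exact ⟨t, ht, fun n => by simpa using hN n, hs⟩

/-- A nonzero polynomial all of whose coefficients have the same sign has no positive zero. -/
lemma SignChangesLE.eval_ne_zero {P : ℝ[X]} (h : SignChangesLE P 0) (hP : P ≠ 0) {x : ℝ}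
    (hx : 0 < x) : P.eval x ≠ 0 := by
  obtain ⟨t, ht, hd, hs⟩ := h
  have htc : ∀ n, t n = t 0 := fun n => le_antisymm (hd n) (ht n.zero_le)
  intro h0
  have hsum : ∑ n ∈ P.support, (-1 : ℝ) ^ t 0 * (P.coeff n * x ^ n) = 0 := by
    rw [← Finset.mul_sum, ← P.sum_def (fun n a => a * x ^ n), ← eval_eq_sum, h0, mul_zero]
  have hnn : ∀ n ∈ P.support, 0 ≤ (-1 : ℝ) ^ t 0 * (P.coeff n * x ^ n) := fun n _ => by
    rw [← mul_assoc]
    exact mul_nonneg (htc n ▸ hs n) (pow_nonneg hx.le n)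
  have := (Finset.sum_eq_zero_iff_of_nonneg hnn).mp hsum P.natDegree
    (natDegree_mem_support_of_nonzero hP)
  simp [hx.ne', hP] at this

/-- Rolle's theorem for `x ↦ P(x) / x ^ N`. -/
lemma exists_eval_X_mul_derivative_sub_eq_zero (P : ℝ[X]) (N : ℕ) {x y : ℝ} (hx : 0 < x)
    (hxy : x < y) (hPx : P.eval x = 0) (hPy : P.eval y = 0) :
    ∃ z, x < z ∧ z < y ∧ (X * derivative P - C (N : ℝ) * P).eval z = 0 := by
  have hder : ∀ z : ℝ, 0 < z → HasDerivAt (fun z => P.eval z / z ^ N)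
      (((derivative P).eval z * z ^ N - P.eval z * (N * z ^ (N - 1))) / (z ^ N) ^ 2) z :=
    fun z hz => (P.hasDerivAt z).div (hasDerivAt_pow N z) (pow_pos hz N).ne'
  obtain ⟨z, ⟨hz1, hz2⟩, hz⟩ := exists_hasDerivAt_eq_zero hxy
    (fun z hz => (hder z (hx.trans_le hz.1)).continuousAt.continuousWithinAt)
    (by simp [hPx, hPy]) (fun z hz => hder z (hx.trans hz.1))
  refine ⟨z, hz1, hz2, ?_⟩
  have hz0 : 0 < z := hx.trans hz1
  rw [div_eq_zero_iff, or_iff_left (pow_pos (pow_pos hz0 N) 2).ne'] at hz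
  have hmul : z ^ N * (X * derivative P - C (N : ℝ) * P).eval z = 0 := by
    have hN : (N : ℝ) * z ^ N = N * z ^ (N - 1) * z := by
      cases N with
      | zero => simp
      | succ n => rw [Nat.add_sub_cancel, pow_succ, mul_assoc]
    simp only [eval_sub, eval_mul, eval_X, eval_C]
    linear_combination z * hz - P.eval z * hN
  exact (mul_eq_zero.mp hmul).resolve_left (pow_pos hz0 N).ne'

/-- Descartes' bound: the number of distinct positive zeros is at most the number of sign
changes. -/
lemma SignChangesLE.card_le {d : ℕ} : ∀ {P : ℝ[X]}, SignChangesLE P d → P ≠ 0 →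
    ∀ s : Finset ℝ, (∀ x ∈ s, 0 < x ∧ P.eval x = 0) → s.card ≤ d := by
  induction d with
  | zero =>
    intro P h hP s hs
    rw [Nat.le_zero, Finset.card_eq_zero, Finset.eq_empty_iff_forall_notMem]
    exact fun x hx => h.eval_ne_zero hP (hs x hx).1 (hs x hx).2
  | succ d ih =>
    intro P h hP s hs
    have hzero : SignChangesLE P 0 → s.card ≤ d + 1 := fun h0 => by
      rw [Finset.eq_empty_iff_forall_notMem.mpr fun x hx =>
        h0.eval_ne_zero hP (hs x hx).1 (hs x hx).2]
      simp
    rcases exists_signChangesLE_X_mul_derivative_sub h with h0 | ⟨N, hQ⟩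
    · exact hzero h0
    · set Q := X * derivative P - C (N : ℝ) * P with hQdef
      by_cases hQ0 : Q = 0
      · -- Then `X P' = N P`, so `P` is a multiple of `X ^ N` and has no positive zero.
        apply hzero
        have hcoeff : ∀ n : ℕ, ((n : ℝ) - N) * P.coeff n = 0 := fun n => by
          rw [← coeff_X_mul_derivative_sub, ← hQdef, hQ0, coeff_zero]
        obtain ⟨t, ht, hd, hs⟩ := h
        refine ⟨fun _ => t N, monotone_const, fun _ => le_rfl, fun n => ?_⟩
        by_cases hn : n = N
        · subst hn; exact hs n
        · have : P.coeff n = 0 := (mul_eq_zero.mp (hcoeff n)).resolve_left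
            (sub_ne_zero.mpr (by exact_mod_cast hn))
          simp [this]
      · have hcard := ih hQ hQ0 (Q.roots.toFinset.filter (0 < ·)) (by
          intro z hz
          simp only [Finset.mem_filter, Multiset.mem_toFinset, mem_roots hQ0] at hz
          exact ⟨hz.2, hz.1⟩)
        refine (Finset.card_le_of_interleaved fun x hx y hy hxy _ => ?_).trans
          (Nat.add_le_add_right hcard 1)
        obtain ⟨z, hz1, hz2, hz⟩ := exists_eval_X_mul_derivative_sub_eq_zero P N (hs x hx).1 hxy
          (hs x hx).2 (hs y hy).2
        refine ⟨z, ?_, hz1, hz2⟩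
        simp only [Finset.mem_filter, Multiset.mem_toFinset, mem_roots hQ0]
        exact ⟨hz, (hs x hx).1.trans hz1⟩

/-! ### Powers of rising factorials -/

/-- The polynomial `∏_{b ≤ a < e} (X + a) ^ m`; for `b = 0` it is the `m`-th power of a rising
factorial, and for general `b ≤ e` it is the quotient of two of these. -/
noncomputable def risingProd (m b e : ℕ) : ℝ[X] :=
  ∏ a ∈ Finset.Ico b e, (X + C (a : ℝ)) ^ m

lemma risingProd_mul (m : ℕ) {b c e : ℕ} (hbc : b ≤ c) (hce : c ≤ e) :
    risingProd m b c * risingProd m c e = risingProd m b e :=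
  Finset.prod_Ico_consecutive _ hbc hce

lemma risingProd_monic (m b e : ℕ) : (risingProd m b e).Monic :=
  monic_prod_of_monic _ _ fun a _ => (monic_X_add_C (a : ℝ)).pow m

lemma natDegree_risingProd (m b e : ℕ) : (risingProd m b e).natDegree = (e - b) * m := by
  rw [risingProd, natDegree_prod_of_monic _ _ fun (a : ℕ) _ => (monic_X_add_C (a : ℝ)).pow m]
  simp only [natDegree_pow, natDegree_X_add_C, mul_one, Finset.sum_const, Nat.card_Ico, smul_eq_mul]

lemma SignChangesLE.risingProd_mul {P : ℝ[X]} {d : ℕ} (h : SignChangesLE P d) (m b e : ℕ) :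
    SignChangesLE (risingProd m b e * P) d := by
  have hpow : ∀ (a k : ℕ) {Q : ℝ[X]}, SignChangesLE Q d →
      SignChangesLE ((X + C (a : ℝ)) ^ k * Q) d := by
    intro a k
    induction k with
    | zero => intro Q hQ; simpa using hQ
    | succ k ih =>
      intro Q hQ
      rw [pow_succ, mul_assoc]
      exact ih (hQ.X_add_C_mul a.cast_nonneg)
  rw [risingProd]
  induction Finset.Ico b e using Finset.induction_on with
  | empty => simpa using h
  | insert a s ha ih =>
    rw [Finset.prod_insert ha, mul_assoc]
    exact hpow a m ih

lemma signChangesLE_sum_risingProd (m : ℕ) {k : ℕ} : ∀ (b : ℕ) (e : Fin (k + 1) → ℕ)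
    (c : Fin (k + 1) → ℝ), Monotone e → b ≤ e 0 →
      SignChangesLE (∑ j, C (c j) * risingProd m b (e j)) k := by
  induction k with
  | zero =>
    intro b e c _ _
    rw [Fin.sum_univ_one, mul_comm]
    exact (signChangesLE_C _).risingProd_mul _ _ _
  | succ k ih =>
    intro b e c he hb
    have hsum : ∑ j, C (c j) * risingProd m b (e j) = risingProd m b (e 0) *
        (C (c 0) + ∑ j : Fin (k + 1), C (c j.succ) * risingProd m (e 0) (e j.succ)) := by
      rw [Fin.sum_univ_succ, mul_add, Finset.mul_sum, mul_comm (C (c 0))]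
      congr 1
      refine Finset.sum_congr rfl fun j _ => ?_
      rw [← _root_.risingProd_mul m hb (he (Fin.zero_le j.succ))]
      ring
    rw [hsum]
    exact ((ih (e 0) (fun j => e j.succ) (fun j => c j.succ)
      (fun i j hij => he (Fin.succ_le_succ_iff.mpr hij)) (he (Fin.zero_le _))).C_add
        _).risingProd_mul _ _ _

/-! ### Positivity of the determinants -/

lemma eventually_eval_pos {P : ℝ[X]} (h : 0 < P.leadingCoeff) :
    ∀ᶠ y in Filter.atTop, 0 < P.eval y := by
  by_cases hdeg : 0 < P.degree
  · exact (tendsto_atTop_of_leadingCoeff_nonneg P hdeg h.le).eventually_gt_atTop 0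
  · rw [eq_C_of_degree_le_zero (not_lt.mp hdeg)] at h ⊢
    rw [leadingCoeff_C] at h
    simp only [eval_C]
    exact Filter.Eventually.of_forall fun _ => h

lemma leadingCoeff_sum_risingProd {m : ℕ} (hm : 0 < m) {k : ℕ} (e : Fin (k + 1) → ℕ)
    (he : StrictMono e) (c : Fin (k + 1) → ℝ) (hc : c (Fin.last k) ≠ 0) :
    (∑ j, C (c j) * risingProd m 0 (e j)).leadingCoeff = c (Fin.last k) := by
  have hmonic := risingProd_monic m 0 (e (Fin.last k))
  have hdeg : ∀ j, (risingProd m 0 (e j)).degree = ((e j * m : ℕ) : WithBot ℕ) := fun j => by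
    rw [degree_eq_natDegree (risingProd_monic m 0 (e j)).ne_zero, natDegree_risingProd,
      Nat.sub_zero]
  rw [Fin.sum_univ_castSucc, leadingCoeff_add_of_degree_lt, leadingCoeff_mul, leadingCoeff_C,
    hmonic.leadingCoeff, mul_one]
  rw [degree_C_mul hc, hdeg]
  refine (degree_sum_le _ _).trans_lt ((Finset.sup_lt_iff (WithBot.bot_lt_coe _)).mpr
    fun j _ => ?_)
  refine (degree_mul_le _ _).trans_lt ?_
  refine (add_le_add_left degree_C_le _).trans_lt ?_
  rw [zero_add, hdeg]
  exact_mod_cast Nat.mul_lt_mul_of_pos_right (he (Fin.castSucc_lt_last j)) hm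

theorem det_risingProd_pos {m : ℕ} (hm : 0 < m) {k : ℕ} : ∀ (e : Fin k → ℕ) (x : Fin k → ℝ),
    StrictMono e → StrictMono x → (∀ i, 0 < x i) →
      0 < (Matrix.of fun i j => (risingProd m 0 (e j)).eval (x i)).det := by
  induction k with
  | zero => intro e x _ _ _; simp
  | succ k ih =>
    intro e x he hx hpos
    -- The cofactors along the last row, which do not involve the last node.
    set c : Fin (k + 1) → ℝ := fun j => (-1) ^ (k + j : ℕ) * (Matrix.of fun i l : Fin k =>
      (risingProd m 0 (e (j.succAbove l))).eval (x i.castSucc)).det with hc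
    set D : ℝ[X] := ∑ j, C (c j) * risingProd m 0 (e j) with hD
    have hdet : ∀ y : ℝ, D.eval y = (Matrix.of fun i j =>
        (risingProd m 0 (e j)).eval (Function.update x (Fin.last k) y i)).det := by
      intro y
      rw [Matrix.det_succ_row _ (Fin.last k), hD, eval_finsetSum]
      refine Finset.sum_congr rfl fun j _ => ?_
      have hsub : ((Matrix.of fun i j =>
          (risingProd m 0 (e j)).eval (Function.update x (Fin.last k) y i)).submatrix
            (Fin.last k).succAbove j.succAbove) = Matrix.of fun (i : Fin k) (l : Fin k) =>
              (risingProd m 0 (e (j.succAbove l))).eval (x i.castSucc) := by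
        ext i l
        simp
      rw [hsub, eval_mul, eval_C, hc]
      simp only [Matrix.of_apply, Function.update_self, Fin.val_last]
      ring
    have hclast : 0 < c (Fin.last k) := by
      have h1 := ih (fun l => e l.castSucc) (fun i => x i.castSucc)
        (he.comp Fin.strictMono_castSucc) (hx.comp Fin.strictMono_castSucc) (fun i => hpos _)
      simp only [hc, Fin.val_last, Fin.succAbove_last]
      rw [Even.neg_one_pow ⟨k, rfl⟩, one_mul]
      exact h1
    have hlead : 0 < D.leadingCoeff := by
      rw [hD, leadingCoeff_sum_risingProd hm e he c hclast.ne']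
      exact hclast
    have hD0 : D ≠ 0 := leadingCoeff_ne_zero.mp hlead.ne'
    have hsign : SignChangesLE D k :=
      signChangesLE_sum_risingProd m 0 e c he.monotone (Nat.zero_le _)
    -- A zero at or beyond the last node would be zero number `k + 1`.
    have hne : ∀ y, x (Fin.last k) ≤ y → D.eval y ≠ 0 := by
      intro y hy h0
      set x' := Function.update x (Fin.last k) y with hx'
      have hlast : x' (Fin.last k) = y := Function.update_self ..
      have hcast : ∀ i : Fin k, x' i.castSucc = x i.castSucc := fun i =>
        Function.update_of_ne (Fin.castSucc_lt_last i).ne ..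
      have hmono : StrictMono x' := by
        intro i j hij
        induction i using Fin.lastCases with
        | last => exact absurd hij (Fin.le_last j).not_gt
        | cast i =>
          rw [hcast]
          induction j using Fin.lastCases with
          | last => rw [hlast]; exact (hx (Fin.castSucc_lt_last i)).trans_le hy
          | cast j => rw [hcast]; exact hx hij
      have hcard := hsign.card_le hD0 (Finset.univ.image x') (by
        intro z hz
        obtain ⟨i, -, rfl⟩ := Finset.mem_image.mp hz
        induction i using Fin.lastCases with
        | last => rw [hlast]; exact ⟨(hpos _).trans_le hy, h0⟩
        | cast i =>
          rw [hcast]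
          refine ⟨hpos _, ?_⟩
          rw [hdet]
          refine Matrix.det_zero_of_row_eq (Fin.castSucc_lt_last i).ne ?_
          ext j
          simp)
      rw [Finset.card_image_of_injective _ hmono.injective, Finset.card_univ,
        Fintype.card_fin] at hcard
      omega
    have hgoal : 0 < D.eval (x (Fin.last k)) := by
      by_contra hcon
      obtain ⟨y, hy0, hy⟩ := ((eventually_eval_pos hlead).and
        (Filter.eventually_ge_atTop (x (Fin.last k)))).exists
      obtain ⟨z, hz, hz0⟩ := intermediate_value_Icc hy D.continuous.continuousOn
        ⟨not_lt.mp hcon, hy0.le⟩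
      exact hne z hz.1 hz0
    rwa [hdet, Function.update_eq_self] at hgoal

/-! ### Gamma and beta matrices -/

lemma Gamma_add_nat_pow {x : ℝ} (hx : 0 < x) (m e : ℕ) :
    Real.Gamma (x + e) ^ m = Real.Gamma x ^ m * (risingProd m 0 e).eval x := by
  induction e with
  | zero => simp [risingProd]
  | succ e ih =>
    have h1 : (risingProd m 0 (e + 1)).eval x = (risingProd m 0 e).eval x * (x + e) ^ m := by
      rw [risingProd, Finset.prod_Ico_succ_top (Nat.zero_le e), ← risingProd]
      simp
    have hxe : x + e ≠ 0 := by positivity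
    rw [h1, Nat.cast_succ, ← add_assoc, Real.Gamma_add_one hxe, mul_pow, ih]
    ring

/-- Multiplying the rows and the columns by positive numbers preserves total positivity. -/
lemma IsTotallyPositive.scale {p q : ℕ} {A : Matrix (Fin p) (Fin q) ℝ} (hA : IsTotallyPositive A)
    {u : Fin p → ℝ} {v : Fin q → ℝ} (hu : ∀ i, 0 < u i) (hv : ∀ j, 0 < v j) :
    IsTotallyPositive (Matrix.of fun i j => v j * (u i * A i j)) := by
  intro k r c hr hc
  have h : (Matrix.of fun i j => v j * (u i * A i j)).submatrix r c = Matrix.of fun i j =>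
      v (c j) * (Matrix.of fun i j => u (r i) * (A.submatrix r c) i j) i j := rfl
  rw [h, Matrix.det_mul_row, Matrix.det_mul_column]
  exact mul_pos (Finset.prod_pos fun _ _ => hv _)
    (mul_pos (Finset.prod_pos fun _ _ => hu _) (hA k r c hr hc))

theorem theorem3p4 (n : ℕ) (lam mu : Fin n → ℝ)
    (hlam_pos : ∀ i, 0 < lam i) (hlam : StrictMono lam)
    (hmu_pos : ∀ j, 0 < mu j) (hmu : StrictMono mu)
    (hdiff : ∀ (i : ℕ) (hi : i + 1 < n), ∃ k : ℕ, 0 < k ∧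
      mu ⟨i + 1, hi⟩ - mu ⟨i, Nat.lt_of_succ_lt hi⟩ = (k : ℝ))
    (m : ℕ) (hm : 0 < m) :
    IsTotallyPositive
        (Matrix.of fun i j : Fin n => Real.Gamma (lam i + mu j) ^ m) ∧
      IsTotallyPositive
        (Matrix.of fun i j : Fin n => 1 / ProbabilityTheory.beta (lam i) (mu j) ^ m) := by
  have hbase : ∃ (b : ℝ) (e : Fin n → ℕ), (∀ i, 0 < lam i + b) ∧ ∀ j, mu j = b + e j := by
    rcases Nat.eq_zero_or_pos n with rfl | hn
    · exact ⟨0, fun _ => 0, fun i => i.elim0, fun j => j.elim0⟩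
    · have h : ∀ (j : ℕ) (hj : j < n), ∃ e : ℕ, mu ⟨j, hj⟩ = mu ⟨0, hn⟩ + e := by
        intro j
        induction j with
        | zero => exact fun _ => ⟨0, by simp⟩
        | succ j ih =>
          intro hj
          obtain ⟨e, he⟩ := ih (Nat.lt_of_succ_lt hj)
          obtain ⟨d, -, hd⟩ := hdiff j hj
          exact ⟨e + d, by push_cast; linarith⟩
      choose e he using h
      exact ⟨mu ⟨0, hn⟩, fun j => e j j.2, fun i => add_pos (hlam_pos i) (hmu_pos _),
        fun j => he j j.2⟩
  obtain ⟨b, e, hb, he⟩ := hbase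
  have he_mono : StrictMono e := fun i j hij => by
    have h := hmu hij
    rw [he i, he j] at h
    exact_mod_cast lt_of_add_lt_add_left h
  have hbasic : IsTotallyPositive
      (Matrix.of fun i j : Fin n => (risingProd m 0 (e j)).eval (lam i + b)) :=
    fun k r c hr hc => det_risingProd_pos hm (fun j => e (c j)) (fun i => lam (r i) + b)
      (he_mono.comp hc) (fun i j hij => by simpa using hlam (hr hij)) (fun i => hb (r i))
  have hGamma : IsTotallyPositive
      (Matrix.of fun i j : Fin n => Real.Gamma (lam i + mu j) ^ m) := by
    convert hbasic.scale (u := fun i => Real.Gamma (lam i + b) ^ m) (v := fun _ => 1)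
      (fun i => pow_pos (Real.Gamma_pos_of_pos (hb i)) m) (fun _ => one_pos) using 4 with i j
    rw [he j, ← add_assoc, Gamma_add_nat_pow (hb i), one_mul]
    rfl
  refine ⟨hGamma, ?_⟩
  convert hGamma.scale (u := fun i => (Real.Gamma (lam i) ^ m)⁻¹)
    (v := fun j => (Real.Gamma (mu j) ^ m)⁻¹)
    (fun i => inv_pos.mpr (pow_pos (Real.Gamma_pos_of_pos (hlam_pos i)) m))
    (fun j => inv_pos.mpr (pow_pos (Real.Gamma_pos_of_pos (hmu_pos j)) m)) using 4 with i j
  have h1 := (Real.Gamma_pos_of_pos (hlam_pos i)).ne'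
  have h2 := (Real.Gamma_pos_of_pos (hmu_pos j)).ne'
  have h3 := (Real.Gamma_pos_of_pos (add_pos (hlam_pos i) (hmu_pos j))).ne'
  rw [ProbabilityTheory.beta, Matrix.of_apply, div_pow, mul_pow]
  field_simp
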